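/- Let $X$ be a Banach space over $\mathbb{K}=\mathbb{R}$ or $\mathbb{C}$. Put $\Pi(X)=\{(x,x^*)\in S_X\times S_{X^*}: x^*(x)=1\}$ and, for a bounded linear operator $T$ on $X$, let $\nu(T)=\sup\{|x^*(Tx)|:(x,x^*)\in\Pi(X)\}$ be its numerical radius (with $\nu(T)=0$ if $X=\{0\}$). Let $\mathcal{L}(X)$ and $\mathcal{K}(X)$ be the sets of bounded and of compact linear operators on $X$, and let $n_K(X)=\inf\{\nu(T): T\in\mathcal{K}(X),\ \|T\|=1\}$ (with $\inf\emptyset=+\infty$, which occurs only for $X=\{0\}$). Given a function $\eta\colon(0,1)\to(0,1)$, the space $X$ has the BPBp-nu for compact operators with the function $\eta$ if for every $\varepsilon\in(0,1)$, whenever $T\in\mathcal{K}(X)$ and $(x,x^*)\in\Pi(X)$ satisfy $\nu(T)=1$ and $|x^*(Tx)|>1-\eta(\varepsilon)$, there exist $S\in\mathcal{K}(X)$ and $(y,y^*)\in\Pi(X)$ such that $$\nu(S)=|y^*(Sy)|=1,\quad \|T-S\|<\varepsilon,\quad \|x-y\|<\varepsilon,\quad \|x^*-y^*\|<\varepsilon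 .$$ The space $X$ has the BPBp-nu (Bishop–Phelps–Bollobás property for numerical radius) for compact operators if this holds for some $\eta$; it has the BPBp-nu if the same holds for some $\eta$ with $\mathcal{K}(X)$ replaced by $\mathcal{L}(X)$ for both $T$ and $S$. Write $\ell_\infty^n(X)$, $\ell_\infty(X)$ and $c_0(X)$ for the spaces of $n$-tuples, of bounded sequences and of null sequences in $X$, with the supremum norm. **Corollary 2.3.** Let $X$ be a Banach space with $n_K(X)>0$. Then the following are equivalent: (i) $c_0(X)$ has the BPBp-nu for compact operators. (ii) There is a function $\eta\colon(0,1)\to(0,1)$ such that all the spaces $\ell_\infty^n(X)$, $n\in\mathbb{N}$, $n\ge 1$, have the BPBp-nu for compact operators with the function $\eta$. Moreover, if $X$ is finite-dimensional, then (i) and (ii) both hold whenever $c_0(X)$ or $\ell_\infty(X)$ has the BPBp-nu. -/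

import Mathlib

open scoped ENNReal

noncomputable section

namespace NumRadius

variable (𝕜 : Type*) [RCLike 𝕜] (X : Type*) [NormedAddCommGroup X] [NormedSpace 𝕜 X]

/-- `Π(X)`: the pairs `(x, x*)` in `S_X × S_{X*}` with `x*(x) = 1`. -/
def statePairs : Set (X × StrongDual 𝕜 X) :=
  {p | ‖p.1‖ = 1 ∧ ‖p.2‖ = 1 ∧ p.2 p.1 = 1}

variable {𝕜 X} in
/-- The numerical radius `ν(T) = sup {|x*(T x)| : (x, x*) ∈ Π(X)}`. The set is bounded above by
`‖T‖`; it is empty only for the zero space, where the supremum is read as `0`. -/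
def numericalRadius (T : X →L[𝕜] X) : ℝ :=
  sSup ((fun p : X × StrongDual 𝕜 X => ‖p.2 (T p.1)‖) '' statePairs 𝕜 X)

/-- The compact operators on `X`. -/
def compactOperators : Set (X →L[𝕜] X) := {T | IsCompactOperator T}

/-- The compact numerical index `n_K(X) = inf {ν(T) : T ∈ K(X), ‖T‖ = 1}`. It lies in `[0, 1]` for
`X ≠ 0`. It is taken in the extended reals so that the infimum of the empty set, which occurs only
for the zero space, is `+∞`. -/
def compactNumericalIndex : EReal :=
  sInf ((fun T : X →L[𝕜] X => (numericalRadius T : EReal)) ''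
    {T | T ∈ compactOperators 𝕜 X ∧ ‖T‖ = 1})

variable {𝕜 X} in
/-- The condition of the Bishop-Phelps-Bollobás property for numerical radius for fixed `ε` and
`η`, where both the given operator `T` and the operator `S` to be found range over `C`. -/
def BPBpNuAt (C : Set (X →L[𝕜] X)) (ε η : ℝ) : Prop :=
  ∀ T ∈ C, ∀ (x : X) (x' : StrongDual 𝕜 X), (x, x') ∈ statePairs 𝕜 X →
    numericalRadius T = 1 → 1 - η < ‖x' (T x)‖ →
    ∃ S ∈ C, ∃ (y : X) (y' : StrongDual 𝕜 X), (y, y') ∈ statePairs 𝕜 X ∧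
      numericalRadius S = 1 ∧ ‖y' (S y)‖ = 1 ∧
      ‖T - S‖ < ε ∧ ‖x - y‖ < ε ∧ ‖x' - y'‖ < ε

/-- `X` has the BPBp-nu. -/
def HasBPBpNu : Prop :=
  ∀ ε ∈ Set.Ioo (0 : ℝ) 1, ∃ η ∈ Set.Ioo (0 : ℝ) 1,
    BPBpNuAt (Set.univ : Set (X →L[𝕜] X)) ε η

/-- `X` has the BPBp-nu for compact operators. -/
def HasBPBpNuCompact : Prop :=
  ∀ ε ∈ Set.Ioo (0 : ℝ) 1, ∃ η ∈ Set.Ioo (0 : ℝ) 1, BPBpNuAt (compactOperators 𝕜 X) ε η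

/-- `X` has the BPBp-nu for compact operators with the function `η : (0,1) → (0,1)`. -/
def HasBPBpNuCompactWith (η : Set.Ioo (0 : ℝ) 1 → Set.Ioo (0 : ℝ) 1) : Prop :=
  ∀ ε : Set.Ioo (0 : ℝ) 1, BPBpNuAt (compactOperators 𝕜 X) (ε : ℝ) (η ε : ℝ)

end NumRadius

/-- `c₀(X)`: the `X`-valued sequences tending to `0`, with the supremum norm. -/
abbrev NumRadius.C0Seq (X : Type*) [NormedAddCommGroup X] : Type _ :=
  ZeroAtInftyContinuousMap ℕ X

/-- `ℓ_∞(X)`: the bounded `X`-valued sequences, with the supremum norm. -/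
abbrev NumRadius.LInfSeq (X : Type*) [NormedAddCommGroup X] : Type _ :=
  lp (fun _ : ℕ => X) ∞

/-- `ℓ_∞^n(X)`: the `n`-tuples in `X`, with the maximum norm. -/
abbrev NumRadius.LInfTuple (n : ℕ) (X : Type*) : Type _ := Fin n → X

end

/-!
The space `ℓ_∞^n(X)` is an `M`-summand both of `c₀(X)` and of `ℓ_∞(X)`: it is the range of a
projection for which the norm of the whole space is the maximum of the norms of the two
components. Two general facts about `M`-summands give the result.

*Passing to an `M`-summand* (`IsMSummand.bpbpNuAt`). If `E` is an `M`-summand of `W`, an operator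
`T` on `E` extends by `0` to `W` with the same numerical radius
(`IsMSummand.numericalRadius_extend`). Let `S` and `(y, y')` be an operator and a state pair given
by the property in `W`. As `y` is close to the point we started from, its component outside `E` has
norm less than `1`, so `y'` vanishes on the complement of `E` (`IsMSummand.apply_compl_eq_zero`).
Hence compressing `S` to `E` along `u ↦ u + y'(u) (y - P y)`, a map which carries `P y` to `y` and
state pairs of `E` to state pairs of `W`, gives the operator and the state pair wanted in `E`. The
same `ε` and `η` work, which yields uniformity in `n`. If `X` is finite-dimensional, every
operator on `ℓ_∞^n(X)` is compact, so the property for all operators is enough.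

*Passing to the limit* (`bpbpNuAt_of_tendsto`). Let `Eₙ` be `M`-summands of `W` whose projections
converge strongly to the identity. The dual norm of `W` is the sum of the dual norms of the
components, so the adjoint projections converge strongly as well, and therefore the compressions
of a compact operator `T` to `Eₙ` converge to `T` in norm (`tendsto_norm_sub_compression`). A state
pair of `W` restricts to a state pair of `Eₙ` for large `n`, because the component of the point
outside `Eₙ` eventually has norm less than `1`. The property in `Eₙ`, applied to the normalized
compression, then gives the property in `W`, with `ε` replaced by a larger number.
-/

namespace NumRadius

open Filter Topology

/-! ### Elementary properties of the numerical radius -/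

section NumericalRadius

variable {𝕜 : Type*} [RCLike 𝕜] {W : Type*} [NormedAddCommGroup W] [NormedSpace 𝕜 W]

theorem norm_apply_le_numericalRadius (T : W →L[𝕜] W) {x : W} {x' : StrongDual 𝕜 W}
    (h : (x, x') ∈ statePairs 𝕜 W) : ‖x' (T x)‖ ≤ numericalRadius T := by
  refine le_csSup ⟨‖T‖, ?_⟩ ⟨(x, x'), h, rfl⟩
  rintro _ ⟨⟨z, z'⟩, ⟨hz, hz', -⟩, rfl⟩
  calc ‖z' (T z)‖ ≤ ‖z'‖ * (‖T‖ * ‖z‖) := z'.le_opNorm_of_le (T.le_opNorm z)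
    _ = ‖T‖ := by simp only at hz hz'; rw [hz, hz']; ring

theorem numericalRadius_nonneg (T : W →L[𝕜] W) : 0 ≤ numericalRadius T :=
  Real.sSup_nonneg (by rintro _ ⟨p, -, rfl⟩; exact norm_nonneg _)

theorem numericalRadius_le {T : W →L[𝕜] W} {c : ℝ} (hc : 0 ≤ c)
    (h : ∀ x x', (x, x') ∈ statePairs 𝕜 W → ‖x' (T x)‖ ≤ c) : numericalRadius T ≤ c :=
  Real.sSup_le (by rintro _ ⟨p, hp, rfl⟩; exact h _ _ hp) hc

theorem numericalRadius_le_add_norm_sub (T S : W →L[𝕜] W) :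
    numericalRadius T ≤ numericalRadius S + ‖T - S‖ := by
  refine numericalRadius_le (add_nonneg (numericalRadius_nonneg S) (norm_nonneg _)) ?_
  intro x x' hx
  have h1 := norm_apply_le_numericalRadius S hx
  obtain ⟨h2, h3, -⟩ := hx
  simp only at h2 h3
  have h4 : ‖x' ((T - S) x)‖ ≤ ‖T - S‖ := by
    calc ‖x' ((T - S) x)‖ ≤ ‖x'‖ * (‖T - S‖ * ‖x‖) := x'.le_opNorm_of_le ((T - S).le_opNorm x)
      _ = ‖T - S‖ := by rw [h2, h3]; ring
  calc ‖x' (T x)‖ = ‖x' (S x) + x' ((T - S) x)‖ := by rw [← map_add]; simp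
    _ ≤ ‖x' (S x)‖ + ‖x' ((T - S) x)‖ := norm_add_le _ _
    _ ≤ _ := add_le_add h1 h4

theorem numericalRadius_smul (c : 𝕜) (T : W →L[𝕜] W) :
    numericalRadius (c • T) = ‖c‖ * numericalRadius T := by
  have key : ∀ (c : 𝕜) (T : W →L[𝕜] W), numericalRadius (c • T) ≤ ‖c‖ * numericalRadius T := by
    intro c T
    refine numericalRadius_le (mul_nonneg (norm_nonneg _) (numericalRadius_nonneg T)) ?_
    intro x x' hx
    simpa using mul_le_mul_of_nonneg_left (norm_apply_le_numericalRadius T hx) (norm_nonneg c)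
  refine le_antisymm (key c T) ?_
  rcases eq_or_ne c 0 with rfl | hc
  · simpa using numericalRadius_nonneg (0 : W →L[𝕜] W)
  · have h := key c⁻¹ (c • T)
    rw [smul_smul, inv_mul_cancel₀ hc, one_smul, norm_inv] at h
    rwa [← le_inv_mul_iff₀ (norm_pos_iff.mpr hc)]

end NumericalRadius

theorem mem_statePairs_of_le {𝕜 : Type*} [RCLike 𝕜] {W : Type*} [NormedAddCommGroup W]
    [NormedSpace 𝕜 W] {x : W} {x' : StrongDual 𝕜 W} (hx : ‖x‖ ≤ 1) (hx' : ‖x'‖ ≤ 1)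
    (h : x' x = 1) : (x, x') ∈ statePairs 𝕜 W := by
  have h1 : 1 ≤ ‖x'‖ * ‖x‖ := by simpa [h] using x'.le_opNorm x
  exact ⟨by nlinarith [norm_nonneg x, norm_nonneg x'], by nlinarith [norm_nonneg x, norm_nonneg x'],
    h⟩

/-! ### `M`-summands -/

section MSummand

variable {𝕜 : Type*} [RCLike 𝕜] {E W : Type*} [NormedAddCommGroup E] [NormedSpace 𝕜 E]
  [NormedAddCommGroup W] [NormedSpace 𝕜 W]

/-- The projection `w ↦ w - J (P w)` onto the complement of the range of `J`. -/
def complProj (J : E →L[𝕜] W) (P : W →L[𝕜] E) : W →L[𝕜] W :=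
  ContinuousLinearMap.id 𝕜 W - J ∘L P

theorem complProj_apply (J : E →L[𝕜] W) (P : W →L[𝕜] E) (w : W) :
    complProj J P w = w - J (P w) := rfl

/-- `J : E → W` embeds `E` as an `M`-summand of `W`, with projection `J ∘ P`: the norm of `w` is
the maximum of the norms of its components `P w` and `w - J (P w)`. -/
structure IsMSummand (J : E →L[𝕜] W) (P : W →L[𝕜] E) : Prop where
  proj_embed : ∀ u, P (J u) = u
  norm_eq_max : ∀ w, ‖w‖ = max ‖P w‖ ‖complProj J P w‖

namespace IsMSummand

variable {J : E →L[𝕜] W} {P : W →L[𝕜] E} (h : IsMSummand J P)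
include h

theorem norm_proj_le (w : W) : ‖P w‖ ≤ ‖w‖ :=
  h.norm_eq_max w ▸ le_max_left _ _

theorem norm_complProj_le (w : W) : ‖complProj J P w‖ ≤ ‖w‖ :=
  h.norm_eq_max w ▸ le_max_right _ _

theorem proj_complProj (w : W) : P (complProj J P w) = 0 := by
  rw [complProj_apply, map_sub, h.proj_embed, sub_self]

theorem norm_embed_add_complProj (u : E) (w : W) :
    ‖J u + complProj J P w‖ = max ‖u‖ ‖complProj J P w‖ := by
  have h1 : P (J u + complProj J P w) = u := by
    rw [map_add, h.proj_embed, h.proj_complProj, add_zero]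
  rw [h.norm_eq_max, h1, complProj_apply J P (J u + _), h1, add_sub_cancel_left]

theorem norm_embed (u : E) : ‖J u‖ = ‖u‖ := by
  simpa using h.norm_embed_add_complProj u 0

theorem norm_comp_proj_le (u' : StrongDual 𝕜 E) : ‖u' ∘L P‖ ≤ ‖u'‖ :=
  ContinuousLinearMap.opNorm_le_bound _ (norm_nonneg _) fun w =>
    u'.le_opNorm_of_le (h.norm_proj_le w)

theorem norm_comp_embed_le (w' : StrongDual 𝕜 W) : ‖w' ∘L J‖ ≤ ‖w'‖ :=
  ContinuousLinearMap.opNorm_le_bound _ (norm_nonneg _) fun u =>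
    w'.le_opNorm_of_le (h.norm_embed u).le

/-- The complement of an `M`-summand is orthogonal to it in the `ℓ₁` sense in the dual. -/
theorem norm_comp_embed_add_norm_comp_complProj_le (w' : StrongDual 𝕜 W) :
    ‖w' ∘L J‖ + ‖w' ∘L complProj J P‖ ≤ ‖w'‖ := by
  have key : ∀ u z, ‖u‖ ≤ 1 → ‖z‖ ≤ 1 → ‖w' (J u)‖ + ‖w' (complProj J P z)‖ ≤ ‖w'‖ := by
    intro u z hu hz
    -- Rotate both components so that the two values add up without cancellation.
    obtain ⟨c, hc, hcu⟩ := RCLike.exists_norm_eq_mul_self (w' (J u))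
    obtain ⟨d, hd, hdz⟩ := RCLike.exists_norm_eq_mul_self (w' (complProj J P z))
    have h1 : ‖J (c • u) + complProj J P (d • z)‖ ≤ 1 := by
      rw [h.norm_embed_add_complProj]
      refine max_le ?_ ((h.norm_complProj_le _).trans ?_) <;> simp [norm_smul, *]
    have h2 : w' (J (c • u) + complProj J P (d • z)) =
        ((‖w' (J u)‖ + ‖w' (complProj J P z)‖ : ℝ) : 𝕜) := by
      simp [hcu, hdz]
    have h3 := w'.le_opNorm_of_le h1
    rwa [h2, RCLike.norm_of_nonneg (by positivity), mul_one] at h3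
  have h1 : ∀ z, ‖z‖ ≤ 1 → ‖w' ∘L J‖ ≤ ‖w'‖ - ‖w' (complProj J P z)‖ := fun z hz =>
    ContinuousLinearMap.opNorm_le_of_unit_norm
      (by have := key 0 z (by simp) hz; simp at this; linarith)
      fun u hu => by have := key u z hu.le hz; simp; linarith
  have h2 : ‖w' ∘L complProj J P‖ ≤ ‖w'‖ - ‖w' ∘L J‖ :=
    ContinuousLinearMap.opNorm_le_of_unit_norm (by linarith [h.norm_comp_embed_le w'])
      fun z hz => by have := h1 z hz.le; simp; linarith
  linarith

theorem extend_mem_statePairs {u : E} {u' : StrongDual 𝕜 E} (hu : (u, u') ∈ statePairs 𝕜 E) :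
    (J u, u' ∘L P) ∈ statePairs 𝕜 W := by
  obtain ⟨h1, h2, h3⟩ := hu
  exact mem_statePairs_of_le ((h.norm_embed u).trans h1).le ((h.norm_comp_proj_le u').trans h2.le)
    (by simpa [h.proj_embed] using h3)

/-- At a point whose component off the `M`-summand is not of full norm, a state vanishes on the
complement, since the point can be moved there in all directions inside the unit ball. -/
theorem apply_compl_eq_zero {y : W} {y' : StrongDual 𝕜 W} (hy : (y, y') ∈ statePairs 𝕜 W)
    (hlt : ‖complProj J P y‖ < 1) (z : W) : y' (complProj J P z) = 0 := by
  obtain ⟨h1, h2, h3⟩ := hy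
  simp only at h1 h2 h3
  have h4 := h.norm_comp_embed_add_norm_comp_complProj_le y'
  have h5 : ‖y' (J (P y))‖ ≤ ‖y' ∘L J‖ := by
    simpa using (y' ∘L J).le_opNorm_of_le ((h.norm_proj_le y).trans h1.le)
  -- With `Q` the complementary projection, `1 = y'(y) ≤ ‖y' ∘ J‖ + ‖y' ∘ Q‖ * ‖Q y‖`, while
  -- `‖y' ∘ J‖ + ‖y' ∘ Q‖ ≤ 1` and `‖Q y‖ < 1`; this forces `y' ∘ Q = 0`.
  have h6 : ‖y' (complProj J P y)‖ ≤ ‖y' ∘L complProj J P‖ * ‖complProj J P y‖ := by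
    have := (y' ∘L complProj J P).le_opNorm (complProj J P y)
    rwa [ContinuousLinearMap.comp_apply, complProj_apply J P (complProj J P y),
      h.proj_complProj, map_zero, sub_zero] at this
  have h7 : (1 : ℝ) ≤ ‖y' (J (P y))‖ + ‖y' (complProj J P y)‖ := by
    have h8 : y' (J (P y)) + y' (complProj J P y) = 1 := by
      rw [← map_add, complProj_apply, add_sub_cancel, h3]
    simpa [h8] using norm_add_le (y' (J (P y))) (y' (complProj J P y))
  have h9 : ‖y' ∘L complProj J P‖ = 0 := by
    nlinarith [norm_nonneg (y' ∘L complProj J P), norm_nonneg (complProj J P y)]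
  simpa using congrArg (fun f : StrongDual 𝕜 W => f z) (norm_eq_zero.mp h9)

theorem restrict_mem_statePairs {y : W} {y' : StrongDual 𝕜 W} (hy : (y, y') ∈ statePairs 𝕜 W)
    (hlt : ‖complProj J P y‖ < 1) : (P y, y' ∘L J) ∈ statePairs 𝕜 E := by
  have h0 := h.apply_compl_eq_zero hy hlt y
  obtain ⟨h1, h2, h3⟩ := hy
  refine mem_statePairs_of_le ((h.norm_proj_le y).trans h1.le)
    ((h.norm_comp_embed_le y').trans h2.le) ?_
  rw [complProj_apply, map_sub, sub_eq_zero] at h0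
  rw [ContinuousLinearMap.comp_apply, ← h0, h3]

theorem comp_embed_comp_proj {y : W} {y' : StrongDual 𝕜 W} (hy : (y, y') ∈ statePairs 𝕜 W)
    (hlt : ‖complProj J P y‖ < 1) : (y' ∘L J) ∘L P = y' := by
  ext z
  have h0 := h.apply_compl_eq_zero hy hlt z
  rw [complProj_apply, map_sub, sub_eq_zero] at h0
  exact h0.symm

/-- Extending an operator by `0` on the complement of an `M`-summand preserves its numerical
radius: the component of a state pair on the summand is, up to a factor in `[0, 1]`, a state
pair. -/
theorem numericalRadius_extend (T : E →L[𝕜] E) :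
    numericalRadius (J ∘L T ∘L P) = numericalRadius T := by
  refine le_antisymm (numericalRadius_le (numericalRadius_nonneg T) ?_)
    (numericalRadius_le (numericalRadius_nonneg _) ?_)
  · rintro w w' ⟨h1, h2, h3⟩
    simp only at h1 h2 h3
    set f := w' ∘L J with hf
    change ‖f (T (P w))‖ ≤ _
    have h4 := h.norm_comp_embed_add_norm_comp_complProj_le w'
    have h5 : ‖w' (complProj J P w)‖ ≤ ‖w' ∘L complProj J P‖ := by
      simpa [h1] using (w' ∘L complProj J P).le_opNorm w
    have h6 : f (P w) + w' (complProj J P w) = 1 := by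
      rw [hf, ContinuousLinearMap.comp_apply, ← map_add, complProj_apply, add_sub_cancel, h3]
    have h7 : ‖f (P w)‖ ≤ ‖f‖ := by
      simpa using f.le_opNorm_of_le ((h.norm_proj_le w).trans h1.le)
    have h8 : ‖f‖ ≤ RCLike.re (f (P w)) := by
      have := congrArg RCLike.re h6
      rw [map_add, RCLike.one_re] at this
      linarith [RCLike.re_le_norm (w' (complProj J P w))]
    have h9 : f (P w) = (‖f‖ : 𝕜) := by
      have ha : RCLike.re (f (P w)) = ‖f (P w)‖ :=
        le_antisymm (RCLike.re_le_norm _) (h7.trans h8)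
      have hb : ‖f (P w)‖ = ‖f‖ := le_antisymm h7 (ha ▸ h8)
      rw [← hb]
      rw [← ha]; exact (RCLike.re_eq_self_of_le ha.ge).symm
    rcases eq_or_ne f 0 with h0 | h0
    · simpa [h0] using numericalRadius_nonneg T
    · have hpos : ‖f‖ ≠ 0 := norm_ne_zero_iff.mpr h0
      have hmem : (P w, (‖f‖⁻¹ : 𝕜) • f) ∈ statePairs 𝕜 E := by
        refine mem_statePairs_of_le ((h.norm_proj_le w).trans h1.le) ?_ ?_
        · simp [norm_smul, hpos]
        · simp [h9, hpos]
      have h10 := norm_apply_le_numericalRadius T hmem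
      have h11 : ‖f‖ ≤ 1 := by linarith [norm_nonneg (w' ∘L complProj J P)]
      rw [smul_apply, norm_smul, norm_inv, RCLike.norm_ofReal, abs_norm,
        inv_mul_le_iff₀ (by positivity)] at h10
      exact h10.trans (mul_le_of_le_one_left (numericalRadius_nonneg T) h11)
  · intro u u' hu
    simpa [h.proj_embed] using
      norm_apply_le_numericalRadius (J ∘L T ∘L P) (h.extend_mem_statePairs hu)

/-- An `M`-summand inherits the Bishop-Phelps-Bollobás condition, with the same `ε` and `η`. The
hypotheses on the classes `C` and `D` of operators say that extension by `0` maps `D` into `C` and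
that compressions map `C` into `D`. -/
theorem bpbpNuAt {C : Set (W →L[𝕜] W)} {D : Set (E →L[𝕜] E)} {ε η : ℝ} (hε : ε ≤ 1)
    (hDC : ∀ T ∈ D, J ∘L T ∘L P ∈ C) (hCD : ∀ S ∈ C, ∀ A : E →L[𝕜] W, P ∘L S ∘L A ∈ D)
    (hW : BPBpNuAt C ε η) : BPBpNuAt D ε η := by
  intro T hT x x' hx hν hη
  obtain ⟨S, hS, y, y', hy, hνS, hyS, hTS, hxy, hxy'⟩ :=
    hW _ (hDC T hT) (J x) (x' ∘L P) (h.extend_mem_statePairs hx)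
      (by rw [h.numericalRadius_extend, hν]) (by simpa [h.proj_embed] using hη)
  have hq : ‖complProj J P y‖ < 1 := by
    have h1 := h.norm_complProj_le (J x - y)
    rw [map_sub, complProj_apply J P (J x), h.proj_embed, sub_self, zero_sub, norm_neg] at h1
    linarith
  have hpair := h.restrict_mem_statePairs hy hq
  -- The lift `u ↦ J u + y'(J u) Q y` sends `P y` back to `y`, unlike `J`.
  set A : E →L[𝕜] W := J + (y' ∘L J).smulRight (complProj J P y) with hA
  have hA_apply : ∀ u, A u = J u + complProj J P (y' (J u) • y) := fun u => by simp [hA]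
  have hPA : ∀ u, P (A u) = u := fun u => by
    rw [hA_apply, map_add, h.proj_embed, h.proj_complProj, add_zero]
  have hA_norm : ∀ u, ‖A u‖ ≤ ‖u‖ := by
    intro u
    rw [hA_apply, h.norm_embed_add_complProj]
    refine max_le le_rfl ?_
    rw [map_smul, norm_smul]
    have h1 : ‖y' (J u)‖ ≤ ‖u‖ := by
      have := (y' ∘L J).le_opNorm u
      rwa [hpair.2.1, one_mul] at this
    exact (mul_le_of_le_one_right (norm_nonneg _) hq.le).trans h1
  have hAy : A (P y) = y := by
    have h1 : y' (J (P y)) = 1 := hpair.2.2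
    rw [hA_apply, h1, one_smul, complProj_apply, add_sub_cancel]
  have hval : y' (J (P (S y))) = y' (S y) :=
    congrArg (fun f : StrongDual 𝕜 W => f (S y)) (h.comp_embed_comp_proj hy hq)
  have hat : ‖(y' ∘L J) ((P ∘L S ∘L A) (P y))‖ = 1 := by
    simpa [hAy, hval] using hyS
  refine ⟨P ∘L S ∘L A, hCD S hS A, P y, y' ∘L J, hpair, le_antisymm ?_ ?_, hat, ?_, ?_, ?_⟩
  · refine numericalRadius_le zero_le_one fun u u' hu => ?_
    have hu' : (A u, u' ∘L P) ∈ statePairs 𝕜 W :=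
      mem_statePairs_of_le ((hA_norm u).trans hu.1.le)
        ((h.norm_comp_proj_le u').trans hu.2.1.le)
        (by rw [ContinuousLinearMap.comp_apply, hPA]; exact hu.2.2)
    exact hνS ▸ norm_apply_le_numericalRadius S hu'
  · exact hat ▸ norm_apply_le_numericalRadius _ hpair
  · refine lt_of_le_of_lt (ContinuousLinearMap.opNorm_le_bound _ (norm_nonneg _) fun u => ?_) hTS
    have h1 : (T - P ∘L S ∘L A) u = P ((J ∘L T ∘L P - S) (A u)) := by
      simp [hPA, h.proj_embed]
    rw [h1]
    exact (h.norm_proj_le _).trans (ContinuousLinearMap.le_opNorm_of_le _ (hA_norm u))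
  · have h1 := h.norm_proj_le (J x - y)
    rw [map_sub, h.proj_embed] at h1
    exact h1.trans_lt hxy
  · have h1 := h.norm_comp_embed_le (x' ∘L P - y')
    have h2 : (x' ∘L P - y') ∘L J = x' - y' ∘L J := by
      ext u; simp [h.proj_embed]
    exact (h2 ▸ h1).trans_lt hxy'

end IsMSummand
end MSummand

/-! ### Strong approximation by `M`-summands -/

section Approximation

variable {𝕜 : Type*} [RCLike 𝕜] {W : Type*} [NormedAddCommGroup W] [NormedSpace 𝕜 W]

/-- Operators which tend to `0` uniformly along all sequences of the unit ball tend to `0` in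
norm. -/
theorem tendsto_norm_zero_of_forall_seq {A : ℕ → W →L[𝕜] W}
    (hA : ∀ z : ℕ → W, (∀ n, ‖z n‖ ≤ 1) → Tendsto (fun n => A n (z n)) atTop (𝓝 0)) :
    Tendsto (fun n => ‖A n‖) atTop (𝓝 0) := by
  have key : ∀ n, ∃ z : W, ‖z‖ ≤ 1 ∧ ‖A n‖ ≤ 2 * ‖A n z‖ := by
    intro n
    by_contra! hn
    have h1 : ‖A n‖ ≤ ‖A n‖ / 2 :=
      ContinuousLinearMap.opNorm_le_of_unit_norm (by positivity)
        fun z hz => by linarith [hn z hz.le]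
    have h2 := hn 0 (by simp)
    simp only [map_zero, norm_zero, mul_zero] at h2
    linarith
  choose z hz hAz using key
  refine squeeze_zero (fun _ => norm_nonneg _) hAz ?_
  simpa using (hA z hz).norm.const_mul 2

variable {E : ℕ → Type*} [∀ n, NormedAddCommGroup (E n)] [∀ n, NormedSpace 𝕜 (E n)]
  {J : ∀ n, E n →L[𝕜] W} {P : ∀ n, W →L[𝕜] E n}

theorem tendsto_complProj_apply (hlim : ∀ w, Tendsto (fun n => J n (P n w)) atTop (𝓝 w)) (w : W) :
    Tendsto (fun n => complProj (J n) (P n) w) atTop (𝓝 0) := by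
  simpa [complProj_apply] using (hlim w).const_sub w

/-- For `M`-summands, strong convergence of the projections implies strong convergence of their
adjoints. -/
theorem tendsto_norm_comp_complProj (h : ∀ n, IsMSummand (J n) (P n))
    (hlim : ∀ w, Tendsto (fun n => J n (P n w)) atTop (𝓝 w)) (φ : StrongDual 𝕜 W) :
    Tendsto (fun n => ‖φ ∘L complProj (J n) (P n)‖) atTop (𝓝 0) := by
  rw [Metric.tendsto_nhds]
  intro δ hδ
  -- The restriction of `φ` to `E n` has norm at least `‖φ (J n (P n w))‖`, which tends to
  -- `‖φ w‖`; so for a nearly norming `w` little of the norm of `φ` is left for the complement.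
  obtain ⟨w, hw, hφw⟩ : ∃ w : W, ‖w‖ ≤ 1 ∧ ‖φ‖ - δ < ‖φ w‖ := by
    by_contra! hcon
    have h0 : 0 ≤ ‖φ‖ - δ := by simpa using (norm_nonneg _).trans (hcon 0 (by simp))
    linarith [ContinuousLinearMap.opNorm_le_of_unit_norm h0 fun w hw => hcon w hw.le]
  have h1 : Tendsto (fun n => ‖φ (J n (P n w))‖) atTop (𝓝 ‖φ w‖) :=
    ((φ.continuous.tendsto w).comp (hlim w)).norm
  filter_upwards [h1.eventually (lt_mem_nhds hφw)] with n hn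
  have h2 : ‖φ (J n (P n w))‖ ≤ ‖φ ∘L J n‖ := by
    simpa using (φ ∘L J n).le_opNorm_of_le (((h n).norm_proj_le w).trans hw)
  rw [dist_zero_right, norm_norm]
  linarith [(h n).norm_comp_embed_add_norm_comp_complProj_le φ]

/-- The compressions of a compact operator to `M`-summands whose projections converge strongly to
the identity converge to it in norm. -/
theorem tendsto_norm_sub_compression (h : ∀ n, IsMSummand (J n) (P n))
    (hlim : ∀ w, Tendsto (fun n => J n (P n w)) atTop (𝓝 w)) {T : W →L[𝕜] W}
    (hT : IsCompactOperator T) :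
    Tendsto (fun n => ‖T - J n ∘L (P n ∘L T ∘L J n) ∘L P n‖) atTop (𝓝 0) := by
  obtain ⟨K, hK, hTK⟩ := hT.image_closedBall_subset_compact (f := (T : W →ₗ[𝕜] W)) 1
  have hmem : ∀ z : W, ‖z‖ ≤ 1 → T z ∈ K := fun z hz => hTK ⟨z, by simpa using hz, rfl⟩
  have hleft : ∀ z : ℕ → W, (∀ n, ‖z n‖ ≤ 1) →
      Tendsto (fun n => complProj (J n) (P n) (T (z n))) atTop (𝓝 0) := by
    intro z hz
    refine tendsto_of_subseq_tendsto fun ns hns => ?_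
    obtain ⟨w, -, φ, hφ, hw⟩ := hK.tendsto_subseq fun n => hmem _ (hz (ns n))
    refine ⟨φ, ?_⟩
    have h1 : Tendsto (fun n => ns (φ n)) atTop atTop := hns.comp hφ.tendsto_atTop
    have h2 : Tendsto (fun n => ‖T (z (ns (φ n))) - w‖ + ‖complProj (J (ns (φ n))) (P (ns (φ n))) w‖)
        atTop (𝓝 0) := by
      simpa using (tendsto_iff_norm_sub_tendsto_zero.mp hw).add
        ((tendsto_complProj_apply hlim w).comp h1).norm
    refine squeeze_zero_norm (fun n => ?_) h2
    calc ‖complProj (J (ns (φ n))) (P (ns (φ n))) (T (z (ns (φ n))))‖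
        = ‖complProj (J (ns (φ n))) (P (ns (φ n))) (T (z (ns (φ n))) - w) +
            complProj (J (ns (φ n))) (P (ns (φ n))) w‖ := by rw [← map_add, sub_add_cancel]
      _ ≤ _ := (norm_add_le _ _).trans (add_le_add_left ((h _).norm_complProj_le _) _)
  have hright : ∀ z : ℕ → W, (∀ n, ‖z n‖ ≤ 1) →
      Tendsto (fun n => T (complProj (J n) (P n) (z n))) atTop (𝓝 0) := by
    intro z hz
    refine tendsto_of_subseq_tendsto fun ns hns => ?_
    obtain ⟨w, -, φ, hφ, hw⟩ := hK.tendsto_subseq fun n =>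
      hmem _ (((h (ns n)).norm_complProj_le _).trans (hz (ns n)))
    refine ⟨φ, ?_⟩
    have h1 : Tendsto (fun n => ns (φ n)) atTop atTop := hns.comp hφ.tendsto_atTop
    -- The limit is annihilated by every functional, as the arguments of `T` are weakly null.
    have hw0 : w = 0 := by
      refine SeparatingDual.eq_zero_of_forall_dual_eq_zero (R := 𝕜) fun f => ?_
      refine tendsto_nhds_unique ((f.continuous.tendsto w).comp hw) ?_
      refine squeeze_zero_norm (fun n => ?_)
        ((tendsto_norm_comp_complProj h hlim (f ∘L T)).comp h1)
      simpa using ((f ∘L T) ∘L complProj (J (ns (φ n))) (P (ns (φ n)))).le_opNorm_of_le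
        (hz (ns (φ n)))
    exact hw0 ▸ hw
  refine tendsto_norm_zero_of_forall_seq fun z hz => ?_
  -- With `p` the projection and `q` its complement, `T - p T p = q T + p T q = q T + T q - q T q`.
  have h1 := ((hleft z hz).add (hright z hz)).sub
    (hleft _ fun n => ((h n).norm_complProj_le _).trans (hz n))
  simp only [add_zero, sub_zero] at h1
  refine h1.congr fun n => ?_
  simp only [complProj_apply, map_sub, sub_apply,
    ContinuousLinearMap.comp_apply]
  abel

/-- The Bishop-Phelps-Bollobás condition for compact operators passes from `M`-summands whose
projections converge strongly to the identity to the whole space, at the cost of enlarging `ε`. -/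
theorem bpbpNuAt_of_tendsto (h : ∀ n, IsMSummand (J n) (P n))
    (hlim : ∀ w, Tendsto (fun n => J n (P n w)) atTop (𝓝 w)) {ε ε' η : ℝ} (hε : 0 < ε)
    (hε' : ε' < ε) (hE : ∀ n, BPBpNuAt (compactOperators 𝕜 (E n)) ε' η) :
    BPBpNuAt (compactOperators 𝕜 W) ε η := by
  intro T hT x x' hx hν hη
  set R : ∀ n, E n →L[𝕜] E n := fun n => P n ∘L T ∘L J n
  set A : ℕ → W →L[𝕜] W := fun n => J n ∘L R n ∘L P n with hA
  have hA0 : Tendsto (fun n => ‖T - A n‖) atTop (𝓝 0) := tendsto_norm_sub_compression h hlim hT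
  have hAT : Tendsto A atTop (𝓝 T) := by
    rw [tendsto_iff_norm_sub_tendsto_zero]
    simpa only [norm_sub_rev] using hA0
  set r : ℕ → ℝ := fun n => numericalRadius (R n)
  have hr : Tendsto r atTop (𝓝 1) := by
    rw [tendsto_iff_norm_sub_tendsto_zero]
    refine squeeze_zero (fun _ => norm_nonneg _) (fun n => ?_) hA0
    have h1 := numericalRadius_le_add_norm_sub T (A n)
    have h2 := numericalRadius_le_add_norm_sub (A n) T
    rw [hA, (h n).numericalRadius_extend, hν] at h1 h2
    rw [norm_sub_rev] at h2
    rw [Real.norm_eq_abs, abs_sub_le_iff]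
    exact ⟨by linarith, by linarith⟩
  have hr' : Tendsto (fun n => (((r n)⁻¹ : ℝ) : 𝕜)) atTop (𝓝 1) := by
    have := (RCLike.continuous_ofReal (K := 𝕜)).tendsto (1 : ℝ)⁻¹
    rw [inv_one, RCLike.ofReal_one] at this
    exact this.comp (by simpa using hr.inv₀ one_ne_zero)
  have hB : Tendsto (fun n => (((r n)⁻¹ : ℝ) : 𝕜) • A n) atTop (𝓝 T) := by
    simpa using hr'.smul hAT
  have hBx : Tendsto (fun n => ‖x' (((((r n)⁻¹ : ℝ) : 𝕜) • A n) x)‖) atTop (𝓝 ‖x' (T x)‖) := by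
    have hc : Continuous fun S : W →L[𝕜] W => ‖x' (S x)‖ := by fun_prop
    exact (hc.tendsto T).comp hB
  have hBn : Tendsto (fun n => ‖T - (((r n)⁻¹ : ℝ) : 𝕜) • A n‖) atTop (𝓝 0) := by
    simpa using (hB.const_sub T).norm
  have hq : Tendsto (fun n => ‖complProj (J n) (P n) x‖) atTop (𝓝 0) := by
    simpa using (tendsto_complProj_apply hlim x).norm
  obtain ⟨n, hn1, hn2, hn3, hn4, hn5⟩ :=
    ((hq.eventually (gt_mem_nhds one_pos)).and <| (hq.eventually (gt_mem_nhds hε)).and <|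
      (hr.eventually (lt_mem_nhds one_pos)).and <| (hBx.eventually (lt_mem_nhds hη)).and
      (hBn.eventually (gt_mem_nhds (sub_pos.mpr hε')))).exists
  set c : 𝕜 := (((r n)⁻¹ : ℝ) : 𝕜) with hc
  have hcr : ‖c‖ * r n = 1 := by
    rw [hc, RCLike.norm_of_nonneg (by positivity), inv_mul_cancel₀ hn3.ne']
  have hJP := h n
  have hx'e := hJP.comp_embed_comp_proj hx hn1
  have hval : ∀ w, x' (J n (P n w)) = x' w := fun w =>
    congrArg (fun f : StrongDual 𝕜 W => f w) hx'e
  obtain ⟨S, hS, y, y', hy, hνS, hyS, hTS, hxy, hxy'⟩ :=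
    hE n (c • R n) (((hT.comp_clm (J n)).clm_comp (P n)).smul c) (P n x) (x' ∘L J n)
      (hJP.restrict_mem_statePairs hx hn1) (by rw [numericalRadius_smul]; exact hcr)
      (by simpa [hA] using hn4)
  refine ⟨J n ∘L S ∘L P n, (hS.comp_clm (P n)).clm_comp (J n), J n y, y' ∘L P n,
    hJP.extend_mem_statePairs hy, by rw [hJP.numericalRadius_extend, hνS],
    by simpa [hJP.proj_embed] using hyS, ?_, ?_, ?_⟩
  · have h1 : ‖c • A n - J n ∘L S ∘L P n‖ ≤ ‖c • R n - S‖ := by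
      refine ContinuousLinearMap.opNorm_le_bound _ (norm_nonneg _) fun w => ?_
      have h2 : (c • A n - J n ∘L S ∘L P n) w = J n ((c • R n - S) (P n w)) := by
        simp [hA]
      rw [h2, hJP.norm_embed]
      exact ContinuousLinearMap.le_opNorm_of_le _ (hJP.norm_proj_le w)
    calc ‖T - J n ∘L S ∘L P n‖ = ‖(T - c • A n) + (c • A n - J n ∘L S ∘L P n)‖ := by
          rw [sub_add_sub_cancel]
      _ ≤ _ := norm_add_le _ _
      _ < ε := by linarith
  · have h1 : x - J n y = J n (P n x - y) + complProj (J n) (P n) x := by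
      rw [complProj_apply, map_sub]; abel
    rw [h1, hJP.norm_embed_add_complProj]
    exact max_lt (hxy.trans hε') hn2
  · have h1 := hJP.norm_comp_proj_le (x' ∘L J n - y')
    have h2 : (x' ∘L J n - y') ∘L P n = x' - y' ∘L P n := by
      ext w; simp [hval]
    rw [h2] at h1
    linarith

end Approximation

/-! ### Spaces of sequences and of tuples -/

section SequenceSpaces

variable {𝕜 : Type*} [RCLike 𝕜] {X : Type*} [NormedAddCommGroup X] [NormedSpace 𝕜 X]

/-- The sequence which continues an `n`-tuple by zeros. -/
def extendZero {n : ℕ} (u : LInfTuple n X) (k : ℕ) : X :=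
  if hk : k < n then u ⟨k, hk⟩ else 0

theorem extendZero_coe {n : ℕ} (u : LInfTuple n X) (i : Fin n) : extendZero u i = u i := by
  simp [extendZero]

theorem extendZero_of_le {n : ℕ} (u : LInfTuple n X) {k : ℕ} (hk : n ≤ k) :
    extendZero u k = 0 := by
  simp [extendZero, hk.not_gt]

theorem norm_extendZero_le {n : ℕ} (u : LInfTuple n X) (k : ℕ) : ‖extendZero u k‖ ≤ ‖u‖ := by
  unfold extendZero
  split_ifs
  · exact norm_le_pi_norm u _
  · simp

theorem extendZero_add {n : ℕ} (u v : LInfTuple n X) (k : ℕ) :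
    extendZero (u + v) k = extendZero u k + extendZero v k := by
  unfold extendZero; split_ifs <;> simp

theorem extendZero_smul {n : ℕ} (c : 𝕜) (u : LInfTuple n X) (k : ℕ) :
    extendZero (c • u) k = c • extendZero u k := by
  unfold extendZero; split_ifs <;> simp

/-- In a space of sequences with the supremum norm, extension by zeros and restriction exhibit the
`n`-tuples as an `M`-summand. Here `ev w` is the sequence of coordinates of `w`. -/
theorem isMSummand_of_sup_norm {W : Type*} [NormedAddCommGroup W] [NormedSpace 𝕜 W]
    (ev : W → ℕ → X) (hev : ∀ v w k, ev (v - w) k = ev v k - ev w k)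
    (hnorm : ∀ (w : W) (C : ℝ), 0 ≤ C → (‖w‖ ≤ C ↔ ∀ k, ‖ev w k‖ ≤ C)) {n : ℕ}
    {J : LInfTuple n X →L[𝕜] W} {P : W →L[𝕜] LInfTuple n X}
    (hJ : ∀ u k, ev (J u) k = extendZero u k) (hP : ∀ w i, P w i = ev w i) :
    IsMSummand J P := by
  have hle : ∀ w k, ‖ev w k‖ ≤ ‖w‖ := fun w => (hnorm w _ (norm_nonneg w)).mp le_rfl
  have hq : ∀ w k, ev (complProj J P w) k = if k < n then 0 else ev w k := by
    intro w k
    rw [complProj_apply, hev, hJ]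
    split_ifs with hk
    · rw [extendZero_coe (P w) ⟨k, hk⟩, hP, sub_self]
    · rw [extendZero_of_le _ (not_lt.mp hk), sub_zero]
  refine ⟨fun u => funext fun i => by rw [hP, hJ, extendZero_coe], fun w => le_antisymm ?_ ?_⟩
  · refine (hnorm w _ (by positivity)).mpr fun k => ?_
    by_cases hk : k < n
    · refine le_max_of_le_left ?_
      simpa [hP] using norm_le_pi_norm (P w) ⟨k, hk⟩
    · refine le_max_of_le_right ?_
      simpa [hq, hk] using hle (complProj J P w) k
  · refine max_le ((pi_norm_le_iff_of_nonneg (norm_nonneg _)).mpr fun i => ?_)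
      ((hnorm _ _ (norm_nonneg _)).mpr fun k => ?_)
    · rw [hP]; exact hle w i
    · rw [hq]
      split_ifs
      · simp
      · exact hle w k

theorem C0Seq.norm_le_iff (f : C0Seq X) {C : ℝ} (hC : 0 ≤ C) : ‖f‖ ≤ C ↔ ∀ k, ‖f k‖ ≤ C :=
  BoundedContinuousFunction.norm_le (f := f.toBCF) hC

theorem tendsto_extendZero {n : ℕ} (u : LInfTuple n X) :
    Tendsto (extendZero u) (cocompact ℕ) (𝓝 0) := by
  rw [cocompact_eq_cofinite, Nat.cofinite_eq_atTop]
  refine tendsto_const_nhds.congr' ?_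
  filter_upwards [eventually_ge_atTop n] with k hk using (extendZero_of_le u hk).symm

/-- Extension by zeros as an operator `ℓ_∞^n(X) → c₀(X)`. -/
noncomputable def C0Seq.embed (𝕜 : Type*) [RCLike 𝕜] (X : Type*) [NormedAddCommGroup X] [NormedSpace 𝕜 X]
    (n : ℕ) : LInfTuple n X →L[𝕜] C0Seq X :=
  LinearMap.mkContinuous
    { toFun := fun u => ⟨⟨extendZero u, continuous_of_discreteTopology⟩, tendsto_extendZero u⟩
      map_add' := fun u v => ZeroAtInftyContinuousMap.ext fun k => extendZero_add u v k
      map_smul' := fun c u => ZeroAtInftyContinuousMap.ext fun k => extendZero_smul c u k } 1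
    fun u => (C0Seq.norm_le_iff _ (by positivity)).mpr fun k => by
      simpa using norm_extendZero_le u k

/-- Restriction to the first `n` coordinates as an operator `c₀(X) → ℓ_∞^n(X)`. -/
noncomputable def C0Seq.proj (𝕜 : Type*) [RCLike 𝕜] (X : Type*) [NormedAddCommGroup X] [NormedSpace 𝕜 X]
    (n : ℕ) : C0Seq X →L[𝕜] LInfTuple n X :=
  LinearMap.mkContinuous
    { toFun := fun f i => f i
      map_add' := fun _ _ => rfl
      map_smul' := fun _ _ => rfl } 1
    fun f => (pi_norm_le_iff_of_nonneg (by positivity)).mpr fun i => by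
      simpa using (C0Seq.norm_le_iff f (norm_nonneg f)).mp le_rfl i

theorem C0Seq.isMSummand (n : ℕ) : IsMSummand (C0Seq.embed 𝕜 X n) (C0Seq.proj 𝕜 X n) :=
  isMSummand_of_sup_norm (fun f k => f k) (fun _ _ _ => rfl)
    (fun f _ hC => C0Seq.norm_le_iff f hC) (fun _ _ => rfl) fun _ _ => rfl

theorem C0Seq.tendsto_embed_proj (f : C0Seq X) :
    Tendsto (fun n => C0Seq.embed 𝕜 X n (C0Seq.proj 𝕜 X n f)) atTop (𝓝 f) := by
  rw [tendsto_iff_norm_sub_tendsto_zero, Metric.tendsto_atTop]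
  intro δ hδ
  have hf : Tendsto f atTop (𝓝 0) := by
    have := f.zero_at_infty'
    rwa [cocompact_eq_cofinite, Nat.cofinite_eq_atTop] at this
  obtain ⟨N, hN⟩ := Metric.tendsto_atTop.mp hf (δ / 2) (half_pos hδ)
  refine ⟨N, fun n hn => ?_⟩
  rw [dist_zero_right, norm_norm]
  refine lt_of_le_of_lt ((C0Seq.norm_le_iff _ (half_pos hδ).le).mpr fun k => ?_) (half_lt_self hδ)
  change ‖extendZero (C0Seq.proj 𝕜 X n f) k - f k‖ ≤ δ / 2
  rcases lt_or_ge k n with hk | hk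
  · have h1 : extendZero (C0Seq.proj 𝕜 X n f) k = f k := extendZero_coe _ (⟨k, hk⟩ : Fin n)
    rw [h1, sub_self, norm_zero]
    exact (half_pos hδ).le
  · rw [extendZero_of_le _ hk, zero_sub, norm_neg]
    simpa using (hN k (hn.trans hk)).le

theorem LInfSeq.norm_le_iff (f : LInfSeq X) {C : ℝ} (hC : 0 ≤ C) : ‖f‖ ≤ C ↔ ∀ k, ‖f k‖ ≤ C :=
  ⟨fun h k => (lp.norm_apply_le_norm ENNReal.top_ne_zero f k).trans h,
    lp.norm_le_of_forall_le hC⟩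

/-- Extension by zeros as an operator `ℓ_∞^n(X) → ℓ_∞(X)`. -/
noncomputable def LInfSeq.embed (𝕜 : Type*) [RCLike 𝕜] (X : Type*) [NormedAddCommGroup X] [NormedSpace 𝕜 X]
    (n : ℕ) : LInfTuple n X →L[𝕜] LInfSeq X :=
  LinearMap.mkContinuous
    { toFun := fun u => ⟨extendZero u, memℓp_infty ⟨‖u‖, by
        rintro _ ⟨k, rfl⟩; exact norm_extendZero_le u k⟩⟩
      map_add' := fun u v => Subtype.ext (funext fun k => extendZero_add u v k)
      map_smul' := fun c u => Subtype.ext (funext fun k => extendZero_smul c u k) } 1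
    fun u => (LInfSeq.norm_le_iff _ (by positivity)).mpr fun k => by
      simpa using norm_extendZero_le u k

/-- Restriction to the first `n` coordinates as an operator `ℓ_∞(X) → ℓ_∞^n(X)`. -/
noncomputable def LInfSeq.proj (𝕜 : Type*) [RCLike 𝕜] (X : Type*) [NormedAddCommGroup X] [NormedSpace 𝕜 X]
    (n : ℕ) : LInfSeq X →L[𝕜] LInfTuple n X :=
  LinearMap.mkContinuous
    { toFun := fun f i => f i
      map_add' := fun _ _ => rfl
      map_smul' := fun _ _ => rfl } 1
    fun f => (pi_norm_le_iff_of_nonneg (by positivity)).mpr fun i => by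
      rw [one_mul]
      exact (LInfSeq.norm_le_iff f (norm_nonneg f)).mp le_rfl i

theorem LInfSeq.isMSummand (n : ℕ) : IsMSummand (LInfSeq.embed 𝕜 X n) (LInfSeq.proj 𝕜 X n) :=
  isMSummand_of_sup_norm (fun f k => f k) (fun _ _ _ => rfl)
    (fun f _ hC => LInfSeq.norm_le_iff f hC) (fun _ _ => rfl) fun _ _ => rfl

/-- A family of spaces satisfying the Bishop-Phelps-Bollobás condition for every `ε`, with an `η`
common to the family, has the property with a common function `η`. -/
theorem exists_hasBPBpNuCompactWith_of_forall
    (h : ∀ ε ∈ Set.Ioo (0 : ℝ) 1, ∃ η ∈ Set.Ioo (0 : ℝ) 1, ∀ n : ℕ,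
      BPBpNuAt (compactOperators 𝕜 (LInfTuple n X)) ε η) :
    ∃ η : Set.Ioo (0 : ℝ) 1 → Set.Ioo (0 : ℝ) 1, ∀ n : ℕ, 1 ≤ n →
      HasBPBpNuCompactWith 𝕜 (LInfTuple n X) η := by
  choose η hη hn using h
  exact ⟨fun ε => ⟨η ε ε.2, hη ε ε.2⟩, fun n _ ε => hn ε ε.2 n⟩

theorem exists_hasBPBpNuCompactWith_of_hasBPBpNuCompact (h : HasBPBpNuCompact 𝕜 (C0Seq X)) :
    ∃ η : Set.Ioo (0 : ℝ) 1 → Set.Ioo (0 : ℝ) 1, ∀ n : ℕ, 1 ≤ n →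
      HasBPBpNuCompactWith 𝕜 (LInfTuple n X) η := by
  refine exists_hasBPBpNuCompactWith_of_forall fun ε hε => ?_
  obtain ⟨η, hη, hW⟩ := h ε hε
  exact ⟨η, hη, fun n => (C0Seq.isMSummand n).bpbpNuAt hε.2.le
    (fun _ hT => (hT.comp_clm (C0Seq.proj 𝕜 X n)).clm_comp (C0Seq.embed 𝕜 X n))
    (fun _ hS A => (hS.comp_clm A).clm_comp (C0Seq.proj 𝕜 X n)) hW⟩

theorem hasBPBpNuCompact_of_hasBPBpNuCompactWith {η : Set.Ioo (0 : ℝ) 1 → Set.Ioo (0 : ℝ) 1}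
    (h : ∀ n : ℕ, 1 ≤ n → HasBPBpNuCompactWith 𝕜 (LInfTuple n X) η) :
    HasBPBpNuCompact 𝕜 (C0Seq X) := by
  intro ε hε
  let δ : Set.Ioo (0 : ℝ) 1 := ⟨ε / 2, half_pos hε.1, by linarith [hε.1, hε.2]⟩
  have hlim : ∀ f : C0Seq X, Tendsto
      (fun n => C0Seq.embed 𝕜 X (n + 1) (C0Seq.proj 𝕜 X (n + 1) f)) atTop (𝓝 f) := fun f =>
    (C0Seq.tendsto_embed_proj (𝕜 := 𝕜) f).comp (tendsto_add_atTop_nat 1)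
  have hE : ∀ n : ℕ, BPBpNuAt (compactOperators 𝕜 (LInfTuple (n + 1) X)) (ε / 2) (η δ : ℝ) :=
    fun n => h (n + 1) (Nat.le_add_left 1 n) δ
  exact ⟨η δ, (η δ).2, bpbpNuAt_of_tendsto (E := fun n => LInfTuple (n + 1) X)
    (J := fun n => C0Seq.embed 𝕜 X (n + 1)) (P := fun n => C0Seq.proj 𝕜 X (n + 1))
    (fun n => C0Seq.isMSummand (n + 1)) hlim hε.1 (half_lt_self hε.1) hE⟩

theorem exists_hasBPBpNuCompactWith_of_hasBPBpNu [FiniteDimensional 𝕜 X] {W : Type*}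
    [NormedAddCommGroup W] [NormedSpace 𝕜 W] {J : ∀ n, LInfTuple n X →L[𝕜] W}
    {P : ∀ n, W →L[𝕜] LInfTuple n X} (hJP : ∀ n, IsMSummand (J n) (P n))
    (h : HasBPBpNu 𝕜 W) :
    ∃ η : Set.Ioo (0 : ℝ) 1 → Set.Ioo (0 : ℝ) 1, ∀ n : ℕ, 1 ≤ n →
      HasBPBpNuCompactWith 𝕜 (LInfTuple n X) η := by
  refine exists_hasBPBpNuCompactWith_of_forall fun ε hε => ?_
  obtain ⟨η, hη, hW⟩ := h ε hε
  refine ⟨η, hη, fun n => (hJP n).bpbpNuAt hε.2.le (fun _ _ => Set.mem_univ _) ?_ hW⟩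
  intro S _ A
  have : LocallyCompactSpace (LInfTuple n X) :=
    have := FiniteDimensional.proper 𝕜 (LInfTuple n X)
    inferInstance
  exact isCompactOperator_id.clm_comp (P n ∘L S ∘L A)

end SequenceSpaces

end NumRadius

theorem corollary2p3 {𝕜 : Type*} [RCLike 𝕜] {X : Type*} [NormedAddCommGroup X]
    [NormedSpace 𝕜 X] [CompleteSpace X] (hX : 0 < NumRadius.compactNumericalIndex 𝕜 X) :
    (NumRadius.HasBPBpNuCompact 𝕜 (NumRadius.C0Seq X) ↔
      ∃ η : Set.Ioo (0 : ℝ) 1 → Set.Ioo (0 : ℝ) 1, ∀ n : ℕ, 1 ≤ n →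
        NumRadius.HasBPBpNuCompactWith 𝕜 (NumRadius.LInfTuple n X) η) ∧
    (FiniteDimensional 𝕜 X →
      (NumRadius.HasBPBpNu 𝕜 (NumRadius.C0Seq X) ∨ NumRadius.HasBPBpNu 𝕜 (NumRadius.LInfSeq X)) →
      NumRadius.HasBPBpNuCompact 𝕜 (NumRadius.C0Seq X) ∧
      ∃ η : Set.Ioo (0 : ℝ) 1 → Set.Ioo (0 : ℝ) 1, ∀ n : ℕ, 1 ≤ n →
        NumRadius.HasBPBpNuCompactWith 𝕜 (NumRadius.LInfTuple n X) η) := by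
  refine ⟨⟨NumRadius.exists_hasBPBpNuCompactWith_of_hasBPBpNuCompact,
    fun ⟨_, h⟩ => NumRadius.hasBPBpNuCompact_of_hasBPBpNuCompactWith h⟩, fun _ h => ?_⟩
  obtain ⟨η, hη⟩ : ∃ η : Set.Ioo (0 : ℝ) 1 → Set.Ioo (0 : ℝ) 1, ∀ n : ℕ, 1 ≤ n →
      NumRadius.HasBPBpNuCompactWith 𝕜 (NumRadius.LInfTuple n X) η := by
    rcases h with h | h
    · exact NumRadius.exists_hasBPBpNuCompactWith_of_hasBPBpNu NumRadius.C0Seq.isMSummand h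
    · exact NumRadius.exists_hasBPBpNuCompactWith_of_hasBPBpNu NumRadius.LInfSeq.isMSummand h
  exact ⟨NumRadius.hasBPBpNuCompact_of_hasBPBpNuCompactWith hη, η, hη⟩
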